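/- Consider the following reporting problems. In the document problems, the input is a finite collection of nonempty strings (documents) over a fixed alphabet with at least two letters, of total length $n$; a query is a pair of nonempty patterns $P_1,P_2$ and asks for all documents $d$ such that: both $P_1$ and $P_2$ occur in $d$ as substrings (2P); $P_1$ occurs in $d$ and $P_2$ does not (FP); neither $P_1$ nor $P_2$ occurs in $d$ (2FP). In Set Intersection (SI), the input is a finite family of finite sets $S_1,\dots,S_m$ of total size $\sum_i|S_i|=n$; a query is a pair of indices $i,j$ and asks for all elements of $S_i\cap S_j$. We write $t$ for the output size of a query and $|q|$ for its pattern length, i.e. $|q|=|P_1|+|P_2|$ in 2P, FP, 2FP, and $|q|=0$ in SI. A pointer-machine data structure stores an input as a finite directed graph with a root, whose vertices (memory cells) have out-degree at most two and each store at most one input element (a document, respectively an element of the universe). It answers a query by exploring a set $W$ of cells that contains the root, in which every cell is reachable from the root by a directed path inside $W$, and such that every element of the output is stored in some cell of $W$. The query time is $|W|$ and the space is the number of cells; everything else is free. The data structure has space $S(n)$ and query time $T$ if, for every $n$ and every input of size $n$, there is such a graph with at most $S(n)$ cells in which every query can be answered by exploring at most $T$ cells. **Theorem.** Consider any of the problems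 2P, FP, 2FP, SI. 1. Any pointer-machine data structure with space $S(n)$ and query time $Q(n)+O(|q|+t)$, where $Q(n)\ge 1$, satisfies $$S(n)\,Q(n)=\Omega\left(n^{2-o(1)}\right).$$ 2. Let $0<\alpha<1/2$ be a constant. Any pointer-machine data structure with space $S(n)$ and query time $O\left((nt)^{1/2-\alpha}+t+|q|+1\right)$ satisfies $$S(n)=\Omega\left(n^{\frac{1+6\alpha}{1+2\alpha}-o(1)}\right).$$ In both parts the $o(1)$ term depends only on the problem (with its alphabet), on the constant hidden in the query time and, in the second part, on $\alpha$, but not on the functions $S$ and $Q$. -/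

import Mathlib

open Filter Topology

/-- The memory of a pointer-machine data structure whose input elements are taken from `U`: a finite
directed graph with a root, in which every vertex (memory cell) has at most two outgoing edges
(pointers) and stores at most one element of `U`. The cells are numbered by `Fin size`. -/
structure PointerMachine (U : Type) where
  /-- the number of memory cells, i.e. the space -/
  size : ℕ
  root : Fin size
  /-- the two pointers of each cell; `none` is the null pointer -/
  ptr : Fin 2 → Fin size → Option (Fin size)
  /-- the input element stored in each cell, if any -/
  elem : Fin size → Option U

namespace PointerMachine

variable {U : Type}

/-- `W` is a possible set of cells explored by a query: it contains the root, and every cell of `W`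
is reached from the root by following pointers through cells of `W` only. -/
def Explores (G : PointerMachine U) (W : Finset (Fin G.size)) : Prop :=
  G.root ∈ W ∧
    ∀ v ∈ W, Relation.ReflTransGen (fun a b => b ∈ W ∧ ∃ i, G.ptr i a = some b) G.root v

/-- The set `R` can be reported within time `T`: some explored set of at most `T` cells contains, for
each element of `R`, a cell that stores it. Everything except the visited cells is free. -/
def Reports (G : PointerMachine U) (R : Finset U) (T : ℝ) : Prop :=
  ∃ W : Finset (Fin G.size),
    G.Explores W ∧ (∀ u ∈ R, ∃ v ∈ W, G.elem v = some u) ∧ (W.card : ℝ) ≤ T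

end PointerMachine

/-- An abstract reporting problem. Every input has a size, a universe of input elements, and a set of
queries; the answer to a query is a finite set of input elements. -/
structure ReportingProblem where
  Input : Type
  size : Input → ℕ
  Elem : Input → Type
  Query : Input → Type
  /-- the number of characters needed to write down the patterns of a query -/
  queryLength : (I : Input) → Query I → ℕ
  answer : (I : Input) → Query I → Finset (Elem I)

/-- There is a pointer-machine data structure for the problem `P` that uses at most `S n` cells on
inputs of size `n` and answers every query in time at most `T n m t`, where `m` is the length of the
query and `t` is the output size. -/
def ReportingProblem.HasDataStructure (P : ReportingProblem)
    (S : ℕ → ℝ) (T : ℕ → ℕ → ℕ → ℝ) : Prop :=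
  ∀ I : P.Input, ∃ G : PointerMachine (P.Elem I),
    (G.size : ℝ) ≤ S (P.size I) ∧
    ∀ q : P.Query I,
      G.Reports (P.answer I q) (T (P.size I) (P.queryLength I q) (P.answer I q).card)

/-- A collection of documents: finitely many nonempty strings over the alphabet `A`. -/
structure DocumentCollection (A : Type) where
  count : ℕ
  doc : Fin count → List A
  doc_ne_nil : ∀ i, doc i ≠ []

/-- The total length of the documents, in characters. -/
def DocumentCollection.totalLength {A : Type} (D : DocumentCollection A) : ℕ :=
  ∑ i, (D.doc i).length

/-- A pattern: a nonempty string. -/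
abbrev Pattern (A : Type) : Type := {p : List A // p ≠ []}

/-- The pattern `p` occurs in the document `d` as a (contiguous) substring. -/
def Pattern.OccursIn {A : Type} (p : Pattern A) (d : List A) : Prop := p.1 <:+: d

open Classical in
/-- The document reporting problem over the alphabet `A` in which a query consists of two patterns
`p₁, p₂` and asks for all documents `d` with `isMatch p₁ p₂ d`. -/
noncomputable def documentProblem (A : Type) (isMatch : Pattern A → Pattern A → List A → Prop) :
    ReportingProblem where
  Input := DocumentCollection A
  size D := D.totalLength
  Elem D := Fin D.count
  Query _ := Pattern A × Pattern A
  queryLength _ q := q.1.1.length + q.2.1.length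
  answer D q := Finset.univ.filter fun i => isMatch q.1 q.2 (D.doc i)

/-- Two patterns (2P): both patterns occur in the document. -/
noncomputable def twoPattern (A : Type) : ReportingProblem :=
  documentProblem A fun p₁ p₂ d => p₁.OccursIn d ∧ p₂.OccursIn d

/-- Forbidden pattern (FP): the first pattern occurs in the document and the second does not. -/
noncomputable def forbiddenPattern (A : Type) : ReportingProblem :=
  documentProblem A fun p₁ p₂ d => p₁.OccursIn d ∧ ¬ p₂.OccursIn d

/-- Two forbidden patterns (2FP): neither pattern occurs in the document. -/
noncomputable def twoForbiddenPatterns (A : Type) : ReportingProblem :=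
  documentProblem A fun p₁ p₂ d => ¬ p₁.OccursIn d ∧ ¬ p₂.OccursIn d

/-- A finite family of subsets of a finite universe. -/
structure SetFamily where
  universeSize : ℕ
  count : ℕ
  sets : Fin count → Finset (Fin universeSize)

/-- Set intersection (SI): a query is a pair of indices `(i, j)` and asks for all elements of the
intersection of the `i`-th and the `j`-th set. The input size is the total size of the sets. -/
def setIntersection : ReportingProblem where
  Input := SetFamily
  size F := ∑ i, (F.sets i).card
  Elem F := Fin F.universeSize
  Query F := Fin F.count × Fin F.count
  queryLength _ _ := 0
  answer F q := F.sets q.1 ∩ F.sets q.2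

/-! Consider answers `R` so large that `#R` dominates the query length and the additive term of the
query time; they are reported by exploring at most `C * #R` cells. At least half of the elements of
`R` lie deep in the explored set and have `h + 1` ancestors there, one at each distance `0, …, h`.
For `h` about `2 * K * C`, counting pairs (element, ancestor) shows that a number of cells
proportional to `#R` have `K` elements of `R` within distance `h` (`Explores.card_le_mul`). A cell
has boundedly many elements that close, hence boundedly many such `K`-subsets. If every `K`-subset
lies in few answers, each cell serves few queries, and the space is at least a constant times the
total size of the answers (`sum_card_le_size`).

Suitable answers come from `u` random words of length `m` over `r` letters: a symbol is a coordinate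
with a letter, and its set consists of the words having that letter there. By a union bound, any `K`
words can be made to agree in fewer than `K` coordinates (`exists_words_agree_lt`), so they share at
most `K ^ 2` pairwise intersections (`card_pairs_le`). The intersections have total size `u * m ^ 2`
and average size `u / r ^ 2`. The input size is `u * m * r` up to a logarithm. With `r` about `n ^
δ`, `u` about `τ * n ^ (3 * δ)` and `m` as large as `n` allows, the typical intersection exceeds `τ`
and the total is `n ^ (2 - O(δ)) / τ`. The time bound dictates `τ`: it is `Q n` in part 1 and the
solution of `(n * τ) ^ (1 / 2 - α) = τ` in part 2. -/

/-- Along a relation, distances from `x` are realised by predecessors. -/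
theorem exists_dist_of_reflTransGen {V : Type*} (E : V → V → Prop) (x : V) :
    ∃ d : V → ℕ, ∀ y, Relation.ReflTransGen E x y → (d y = 0 → y = x) ∧
      ∀ k, d y = k + 1 → ∃ w, Relation.ReflTransGen E x w ∧ d w = k ∧ E w y := by
  classical
  let reach : ℕ → V → Prop := fun k => Nat.rec (fun v => v = x) (fun _ p v => ∃ w, p w ∧ E w v) k
  have reach_zero (v) : reach 0 v ↔ v = x := Iff.rfl
  have reach_succ (k v) : reach (k + 1) v ↔ ∃ w, reach k w ∧ E w v := Iff.rfl
  have hreach : ∀ y, Relation.ReflTransGen E x y → ∃ k, reach k y := by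
    intro y hy
    induction hy with
    | refl => exact ⟨0, rfl⟩
    | tail _ hbc ih => obtain ⟨k, hk⟩ := ih; exact ⟨k + 1, _, hk, hbc⟩
  have hgen : ∀ k y, reach k y → Relation.ReflTransGen E x y := by
    intro k
    induction k with
    | zero => intro y hy; rw [reach_zero] at hy; rw [hy]
    | succ k ih => intro y ⟨w, hw, hwy⟩; exact (ih w hw).tail hwy
  -- The length of a shortest walk; unreachable points get the junk value `sInf ∅ = 0`, which the
  -- reachability hypothesis excludes.
  refine ⟨fun y => sInf {k | reach k y}, fun y hy => ?_⟩
  have hmem : reach (sInf {k | reach k y}) y := Nat.sInf_mem (hreach y hy)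
  refine ⟨fun h0 => ?_, fun k hk => ?_⟩
  · simp only at h0
    rw [h0] at hmem
    exact hmem
  · simp only at hk
    rw [hk] at hmem
    obtain ⟨w, hw, hwy⟩ := hmem
    refine ⟨w, hgen k w hw, le_antisymm (Nat.sInf_le hw) ?_, hwy⟩
    have h1 : reach (sInf {k | reach k w}) w := Nat.sInf_mem (s := {k | reach k w}) ⟨k, hw⟩
    have h2 : sInf {k | reach k y} ≤ sInf {k | reach k w} + 1 := Nat.sInf_le ⟨w, h1, hwy⟩
    simp only
    omega

/-! ### Counting in the pointer machine -/

namespace PointerMachine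

variable {U : Type}

/-- The cells that can be reached from a given cell by following at most `h` pointers. -/
def ball (G : PointerMachine U) : ℕ → Fin G.size → Finset (Fin G.size)
  | 0, v => {v}
  | h + 1, v => insert v (Finset.univ.biUnion fun i => (G.ptr i v).elim ∅ (ball G h))

theorem self_mem_ball (G : PointerMachine U) (h : ℕ) (v : Fin G.size) : v ∈ G.ball h v := by
  cases h <;> simp [ball]

theorem mem_ball_succ (G : PointerMachine U) {h : ℕ} {v w y : Fin G.size} {i : Fin 2}
    (hi : G.ptr i v = some w) (hy : y ∈ G.ball h w) : y ∈ G.ball (h + 1) v := by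
  rw [ball]
  refine Finset.mem_insert_of_mem (Finset.mem_biUnion.2 ⟨i, Finset.mem_univ _, ?_⟩)
  simpa [hi] using hy

theorem ball_subset_succ (G : PointerMachine U) (h : ℕ) (v : Fin G.size) :
    G.ball h v ⊆ G.ball (h + 1) v := by
  induction h generalizing v with
  | zero => simp [ball]
  | succ h ih =>
    intro y hy
    rw [ball, Finset.mem_insert, Finset.mem_biUnion] at hy
    rcases hy with rfl | ⟨i, -, hy⟩
    · exact G.self_mem_ball _ _
    · cases hw : G.ptr i v with
      | none => simp [hw] at hy
      | some w => rw [hw] at hy; exact G.mem_ball_succ hw (ih w hy)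

theorem ball_mono (G : PointerMachine U) (v : Fin G.size) : Monotone fun h => G.ball h v :=
  monotone_nat_of_le_succ fun h => G.ball_subset_succ h v

theorem card_ball_lt (G : PointerMachine U) (h : ℕ) (v : Fin G.size) :
    (G.ball h v).card < 2 ^ (h + 1) := by
  induction h generalizing v with
  | zero => simp [ball]
  | succ h ih =>
    have h1 : ∀ i ∈ (Finset.univ : Finset (Fin 2)),
        ((G.ptr i v).elim ∅ (G.ball h)).card ≤ 2 ^ (h + 1) - 1 := by
      intro i _
      cases G.ptr i v with
      | none => simp
      | some w => exact Nat.le_sub_one_of_lt (ih w)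
    have h2 := Finset.card_biUnion_le_card_mul _ _ _ h1
    have h3 := Finset.card_insert_le v
      (Finset.univ.biUnion fun i => (G.ptr i v).elim ∅ (G.ball h))
    rw [ball]
    simp only [Finset.card_univ, Fintype.card_fin] at h2
    have : 0 < 2 ^ (h + 1) := by positivity
    rw [pow_succ 2 (h + 1)]
    omega

open Classical in
/-- The elements stored in the cells that are reached by following at most `h` pointers. -/
noncomputable def stored (G : PointerMachine U) (h : ℕ) (v : Fin G.size) : Finset U :=
  (G.ball h v).biUnion fun w => (G.elem w).toFinset

theorem mem_stored (G : PointerMachine U) {h : ℕ} {v w : Fin G.size} {u : U}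
    (hw : w ∈ G.ball h v) (hu : G.elem w = some u) : u ∈ G.stored h v := by
  classical
  exact Finset.mem_biUnion.2 ⟨w, hw, by simp [hu]⟩

theorem card_stored_le (G : PointerMachine U) (h : ℕ) (v : Fin G.size) :
    (G.stored h v).card ≤ 2 ^ (h + 1) := by
  classical
  have := Finset.card_biUnion_le_card_mul (G.ball h v) (fun w => (G.elem w).toFinset) 1
    (fun w _ => by cases G.elem w <;> simp)
  have h2 := G.card_ball_lt h v
  unfold stored
  omega

theorem card_le_size_of_reports (G : PointerMachine U) {R : Finset U} {T : ℝ}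
    (hR : G.Reports R T) : R.card ≤ G.size := by
  classical
  obtain ⟨W, -, hW, -⟩ := hR
  have : Nonempty (Fin G.size) := ⟨G.root⟩
  choose! g hg using hW
  calc R.card ≤ (Finset.univ : Finset (Fin G.size)).card :=
        Finset.card_le_card_of_injOn g (fun _ _ => Finset.mem_coe.2 (Finset.mem_univ _))
          fun a ha b hb hab => by
            have h1 := (hg a ha).2
            rw [hab, (hg b hb).2] at h1
            exact (Option.some.inj h1).symm
    _ = G.size := by simp

/-- Distances inside an explored set, with ancestors at every smaller distance. -/
theorem Explores.exists_dist {G : PointerMachine U} {W : Finset (Fin G.size)} (hW : G.Explores W) :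
    ∃ d : Fin G.size → ℕ, (∀ y ∈ W, y ∈ G.ball (d y) G.root) ∧
      ∀ j, ∀ y ∈ W, j ≤ d y → ∃ v ∈ W, d v + j = d y ∧ y ∈ G.ball j v := by
  obtain ⟨hroot, hreach⟩ := hW
  obtain ⟨d, hd⟩ := exists_dist_of_reflTransGen
    (fun a b => b ∈ W ∧ ∃ i, G.ptr i a = some b) G.root
  have hmem : ∀ y, Relation.ReflTransGen (fun a b => b ∈ W ∧ ∃ i, G.ptr i a = some b) G.root y →
      y ∈ W := by
    intro y hy
    cases hy with
    | refl => exact hroot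
    | tail _ h => exact h.1
  have hanc : ∀ j, ∀ y ∈ W, j ≤ d y → ∃ v ∈ W, d v + j = d y ∧ y ∈ G.ball j v := by
    intro j
    induction j with
    | zero => exact fun y hy _ => ⟨y, hy, by simp, G.self_mem_ball _ _⟩
    | succ j ih =>
      intro y hy hj
      obtain ⟨v, hv, hvd, hyv⟩ := ih y hy (by omega)
      obtain ⟨w, hw, hwd, -, i, hi⟩ := (hd v (hreach v hv)).2 (d v - 1) (by omega)
      exact ⟨w, hmem w hw, by omega, G.mem_ball_succ hi hyv⟩
  refine ⟨d, fun y hy => ?_, hanc⟩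
  obtain ⟨v, hv, hvd, hyv⟩ := hanc (d y) y hy le_rfl
  rwa [(hd v (hreach v hv)).1 (by omega)] at hyv

open Classical in
/-- If a large answer `R` is reported in linear time, then a constant fraction of `#R` cells have at
least `K` elements of `R` within bounded distance. -/
theorem Explores.card_le_mul {G : PointerMachine U} {W : Finset (Fin G.size)} (hW : G.Explores W)
    {R : Finset U} (hR : ∀ u ∈ R, ∃ v ∈ W, G.elem v = some u) {K C : ℕ}
    (hC : W.card ≤ C * R.card) {h : ℕ} (hh : h = 2 * (K * C) + 1) (hlarge : 2 ^ (h + 2) ≤ R.card) :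
    R.card ≤ 2 ^ (h + 1) *
      (Finset.univ.filter fun v : Fin G.size => K ≤ (R ∩ G.stored h v).card).card := by
  obtain ⟨d, hd, hanc⟩ := hW.exists_dist
  have : Nonempty (Fin G.size) := ⟨G.root⟩
  choose! g hgW hg using hR
  have hinj : Set.InjOn g R := fun a ha b hb hab => by
    have h1 := hg a ha
    rw [hab, hg b hb] at h1
    exact (Option.some.inj h1).symm
  set B := Finset.univ.filter fun v : Fin G.size => K ≤ (R ∩ G.stored h v).card with hB
  -- Pairs (element, ancestor within distance `h`) are counted twice: from the cells here, from the
  -- elements in `hlower`.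
  have hupper : ∀ v ∈ W, (R.filter fun u => g u ∈ G.ball h v).card ≤
      K + if v ∈ B then 2 ^ (h + 1) else 0 := by
    intro v _
    have hsub : (R.filter fun u => g u ∈ G.ball h v) ⊆ R ∩ G.stored h v := by
      intro u hu
      rw [Finset.mem_filter] at hu
      exact Finset.mem_inter.2 ⟨hu.1, G.mem_stored hu.2 (hg u hu.1)⟩
    have h1 := Finset.card_le_card hsub
    split_ifs with hv
    · have h2 := Finset.card_le_card (Finset.inter_subset_right (s₁ := R) (s₂ := G.stored h v))
      have h3 := G.card_stored_le h v
      omega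
    · simp only [hB, Finset.mem_filter, Finset.mem_univ, true_and, not_le] at hv
      omega
  have hlower : ∀ u ∈ R.filter (fun u => h ≤ d (g u)),
      h + 1 ≤ (W.filter fun v => g u ∈ G.ball h v).card := by
    intro u hu
    rw [Finset.mem_filter] at hu
    -- One ancestor per distance; they are distinct because their depths differ.
    have hanc' : ∀ j ≤ h, ∃ v ∈ W, d v + j = d (g u) ∧ g u ∈ G.ball j v := fun j hj =>
      hanc j (g u) (hgW u hu.1) (hj.trans hu.2)
    choose! a haW had hab using hanc'
    calc h + 1 = (Finset.range (h + 1)).card := by simp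
      _ ≤ _ := Finset.card_le_card_of_injOn a ?_ ?_
    · intro j hj
      have hj : j ≤ h := by simpa [Nat.lt_succ_iff] using hj
      exact Finset.mem_coe.2 (Finset.mem_filter.2 ⟨haW j hj, G.ball_mono _ hj (hab j hj)⟩)
    · intro i hi j hj hij
      have hi : i ≤ h := by simpa [Nat.lt_succ_iff] using hi
      have hj : j ≤ h := by simpa [Nat.lt_succ_iff] using hj
      have h1 := had i hi
      have h2 := had j hj
      rw [hij] at h1
      omega
  have hshallow : (R.filter fun u => ¬ h ≤ d (g u)).card ≤ 2 ^ (h + 1) := by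
    refine le_trans (Finset.card_le_card_of_injOn (t := G.ball h G.root) g ?_ ?_)
      (G.card_ball_lt h G.root).le
    · intro u hu
      simp only [Finset.coe_filter, Set.mem_ofPred_eq, not_le] at hu
      exact G.ball_mono _ hu.2.le (hd _ (hgW u hu.1))
    · exact hinj.mono (Finset.coe_subset.2 (Finset.filter_subset _ _))
  have hsplit := Finset.card_filter_add_card_filter_not (s := R) (fun u => h ≤ d (g u))
  have hcount : (h + 1) * (R.filter fun u => h ≤ d (g u)).card ≤ K * W.card + 2 ^ (h + 1) * B.card := by
    calc (h + 1) * (R.filter fun u => h ≤ d (g u)).card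
        ≤ ∑ u ∈ R.filter (fun u => h ≤ d (g u)), (W.filter fun v => g u ∈ G.ball h v).card := by
          rw [mul_comm, ← smul_eq_mul]
          exact Finset.card_nsmul_le_sum _ _ _ hlower
      _ ≤ ∑ u ∈ R, (W.filter fun v => g u ∈ G.ball h v).card :=
          Finset.sum_le_sum_of_subset (Finset.filter_subset _ _)
      _ = ∑ v ∈ W, (R.filter fun u => g u ∈ G.ball h v).card :=
          Finset.sum_card_bipartiteAbove_eq_sum_card_bipartiteBelow fun u v => g u ∈ G.ball h v
      _ ≤ ∑ v ∈ W, (K + if v ∈ B then 2 ^ (h + 1) else 0) := Finset.sum_le_sum hupper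
      _ ≤ K * W.card + 2 ^ (h + 1) * B.card := by
          rw [Finset.sum_add_distrib, Finset.sum_const, smul_eq_mul, mul_comm, Finset.sum_ite,
            Finset.sum_const_zero, add_zero, Finset.sum_const, smul_eq_mul, mul_comm (2 ^ (h + 1))]
          gcongr
          exact fun v hv => (Finset.mem_filter.1 hv).2
  have hKW : K * W.card ≤ K * C * R.card := by rw [mul_assoc]; gcongr
  -- Elements at depth below `h` sit in the ball of the root, which `hlarge` makes at most half of
  -- `R`.
  have h2 : R.card ≤ 2 * (R.filter fun u => h ≤ d (g u)).card := by
    rw [pow_succ] at hlarge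
    omega
  -- Since `h + 1 = 2 * (K * C + 1)`, the left side exceeds by one `#R` the contribution `K * C *
  -- #R` of cells poor in `R`; the cells of `B` must supply the rest.
  have h3 : (K * C + 1) * R.card ≤ (h + 1) * (R.filter fun u => h ≤ d (g u)).card := by
    calc (K * C + 1) * R.card ≤ (K * C + 1) * (2 * (R.filter fun u => h ≤ d (g u)).card) := by gcongr
      _ = _ := by rw [hh]; ring
  linarith

/-- If no `K` elements are shared by more than `N` of the given answers, each of which is reported in
linear time, then the total size of the answers is linear in the space. -/
theorem sum_card_le_size (G : PointerMachine U) {ι : Type*} (J : Finset ι) (R : ι → Finset U)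
    {K C N h : ℕ} (hh : h = 2 * (K * C) + 1) (hlarge : ∀ q ∈ J, 2 ^ (h + 2) ≤ (R q).card)
    (hrep : ∀ q ∈ J, G.Reports (R q) ((C * (R q).card : ℕ) : ℝ))
    (hshare : ∀ X : Finset U, X.card = K → ∀ J' ⊆ J, (∀ q ∈ J', X ⊆ R q) → J'.card ≤ N) :
    ∑ q ∈ J, (R q).card ≤ 2 ^ (h + 1) * ((2 ^ (h + 1)) ^ K * N) * G.size := by
  classical
  have h1 : ∀ q ∈ J, (R q).card ≤ 2 ^ (h + 1) *
      (Finset.univ.filter fun v : Fin G.size => K ≤ (R q ∩ G.stored h v).card).card := by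
    intro q hq
    obtain ⟨W, hW, hR, hT⟩ := hrep q hq
    convert hW.card_le_mul hR (K := K) (C := C) (by exact_mod_cast hT) hh (hlarge q hq) using 2
  have h2 : ∀ v ∈ (Finset.univ : Finset (Fin G.size)),
      (J.filter fun q => K ≤ (R q ∩ G.stored h v).card).card ≤ (2 ^ (h + 1)) ^ K * N := by
    intro v _
    -- A query served by `v` is charged to a `K`-subset of the elements stored near `v`.
    have hsub : (J.filter fun q => K ≤ (R q ∩ G.stored h v).card) ⊆
        (Finset.powersetCard K (G.stored h v)).biUnion fun X => J.filter fun q => X ⊆ R q := by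
      intro q hq
      rw [Finset.mem_filter] at hq
      obtain ⟨X, hX, hXc⟩ := Finset.exists_subset_card_eq hq.2
      simp only [Finset.mem_biUnion, Finset.mem_powersetCard, Finset.mem_filter]
      exact ⟨X, ⟨hX.trans Finset.inter_subset_right, hXc⟩, hq.1, hX.trans Finset.inter_subset_left⟩
    refine (Finset.card_le_card hsub).trans ?_
    refine (Finset.card_biUnion_le_card_mul _ _ N fun X hX => ?_).trans ?_
    · exact hshare X (Finset.mem_powersetCard.1 hX).2 _ (Finset.filter_subset _ _)
        fun q hq => (Finset.mem_filter.1 hq).2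
    · gcongr
      rw [Finset.card_powersetCard]
      exact (Nat.choose_le_pow _ _).trans (Nat.pow_le_pow_left (G.card_stored_le h v) K)
  calc ∑ q ∈ J, (R q).card
      ≤ ∑ q ∈ J, 2 ^ (h + 1) *
        (Finset.univ.filter fun v : Fin G.size => K ≤ (R q ∩ G.stored h v).card).card :=
        Finset.sum_le_sum h1
    _ = 2 ^ (h + 1) * ∑ v : Fin G.size, (J.filter fun q => K ≤ (R q ∩ G.stored h v).card).card := by
        rw [← Finset.mul_sum]
        congr 1
        exact Finset.sum_card_bipartiteAbove_eq_sum_card_bipartiteBelow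
          fun q v => K ≤ (R q ∩ G.stored h v).card
    _ ≤ 2 ^ (h + 1) * (G.size * ((2 ^ (h + 1)) ^ K * N)) := by
        gcongr
        simpa using Finset.sum_le_card_nsmul _ _ _ h2
    _ = _ := by ring

end PointerMachine

/-! ### Words that rarely agree -/

open Classical in
/-- The families of words, indexed by `ι`, whose members in `X` agree at the coordinates in `B`. -/
noncomputable def agreeing {ι κ : Type*} [Fintype ι] [Fintype κ] (r : ℕ) (X : Finset ι)
    (B : Finset κ) : Finset (ι → κ → Fin r) :=
  Finset.univ.filter fun f => ∀ b ∈ B, ∀ x ∈ X, ∀ y ∈ X, f x b = f y b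

theorem mem_agreeing {ι κ : Type*} [Fintype ι] [Fintype κ] {r : ℕ} {X : Finset ι} {B : Finset κ}
    {f : ι → κ → Fin r} : f ∈ agreeing r X B ↔ ∀ b ∈ B, ∀ x ∈ X, ∀ y ∈ X, f x b = f y b := by
  simp [agreeing]

/-- Among the `r`-ary words indexed by `ι`, the fraction of those that are constant on `X` at each of
the coordinates in `B` is at most `r ^ (-#B * (#X - 1))`. -/
theorem card_agree_mul_le {ι κ : Type*} [Fintype ι] [Fintype κ] [DecidableEq ι] [DecidableEq κ]
    {r : ℕ} (X : Finset ι) (B : Finset κ) (hX : X.Nonempty) :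
    (agreeing r X B).card * r ^ (B.card * (X.card - 1)) ≤ Fintype.card (ι → κ → Fin r) := by
  obtain ⟨x₀, hx₀⟩ := hX
  have hcard : r ^ (B.card * (X.card - 1)) =
      (Finset.univ : Finset (X.erase x₀ → B → Fin r)).card := by
    rw [Finset.card_univ, Fintype.card_fun, Fintype.card_fun, Fintype.card_fin, Fintype.card_coe,
      Fintype.card_coe, Finset.card_erase_of_mem hx₀, pow_mul]
  rw [hcard, ← Finset.card_product, ← Finset.card_univ]
  -- Overwrite an agreeing family on `X.erase x₀` and `B` by arbitrary letters. Nothing is lost,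
  -- because the untouched row `x₀` determines the overwritten values.
  refine Finset.card_le_card_of_injOn (fun p x b =>
    if h : x ∈ X.erase x₀ ∧ b ∈ B then p.2 ⟨x, h.1⟩ ⟨b, h.2⟩ else p.1 x b) (by simp) ?_
  rintro ⟨f, g⟩ hf ⟨f', g'⟩ hf' heq
  simp only [Finset.coe_product, Set.mem_prod, Finset.mem_coe, mem_agreeing, Finset.mem_univ,
    and_true] at hf hf'
  have hval := fun x b => congrFun (congrFun heq x) b
  simp only at hval
  have hout : ∀ x b, ¬ (x ∈ X.erase x₀ ∧ b ∈ B) → f x b = f' x b := by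
    intro x b h
    simpa only [dif_neg h] using hval x b
  refine Prod.ext ?_ ?_
  · funext x b
    by_cases h : x ∈ X.erase x₀ ∧ b ∈ B
    · have hx := Finset.mem_of_mem_erase h.1
      change f x b = f' x b
      rw [hf b h.2 x hx x₀ hx₀, hf' b h.2 x hx x₀ hx₀]
      exact hout x₀ b (by simp)
    · exact hout x b h
  · funext x b
    have h := hval x b
    rw [dif_pos ⟨x.2, b.2⟩, dif_pos ⟨x.2, b.2⟩] at h
    exact h

/-- There are `u` words of length `m` over `r` letters, any `K` of which agree in fewer than `K`
coordinates. -/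
theorem exists_words_agree_lt {u m r K : ℕ} (hr : 0 < r) (hK : 0 < K) (h : u * m < r ^ (K - 1)) :
    ∃ f : Fin u → Fin m → Fin r, ∀ X : Finset (Fin u), X.card = K →
      ∀ B : Finset (Fin m), (∀ b ∈ B, ∀ x ∈ X, ∀ y ∈ X, f x b = f y b) → B.card < K := by
  classical
  by_contra! hcon
  set A := fun p : Finset (Fin u) × Finset (Fin m) => agreeing r p.1 p.2 with hA
  set I := Finset.powersetCard K (Finset.univ : Finset (Fin u)) ×ˢ
    Finset.powersetCard K (Finset.univ : Finset (Fin m)) with hI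
  have hcover : (Finset.univ : Finset (Fin u → Fin m → Fin r)) ⊆ I.biUnion A := by
    intro f _
    obtain ⟨X, hX, B, hB, hBK⟩ := hcon f
    obtain ⟨B', hB', hB'K⟩ := Finset.exists_subset_card_eq hBK
    refine Finset.mem_biUnion.2 ⟨(X, B'), ?_, ?_⟩
    · simp [hI, Finset.mem_powersetCard, hX, hB'K]
    · exact mem_agreeing.2 fun b hb => hB b (hB' hb)
  set F := Fintype.card (Fin u → Fin m → Fin r) with hF
  have hFpos : 0 < F := by
    rw [hF, Fintype.card_fun, Fintype.card_fun, Fintype.card_fin]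
    positivity
  have hIcard : I.card ≤ (u * m) ^ K := by
    rw [hI, Finset.card_product, Finset.card_powersetCard, Finset.card_powersetCard, mul_pow]
    simpa using Nat.mul_le_mul (Nat.choose_le_pow u K) (Nat.choose_le_pow m K)
  have h1 : F * r ^ (K * (K - 1)) ≤ (u * m) ^ K * F := by
    calc F * r ^ (K * (K - 1)) ≤ (∑ p ∈ I, (A p).card) * r ^ (K * (K - 1)) := by
          gcongr
          rw [hF, ← Finset.card_univ]
          exact (Finset.card_le_card hcover).trans Finset.card_biUnion_le
      _ = ∑ p ∈ I, (A p).card * r ^ (K * (K - 1)) := Finset.sum_mul _ _ _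
      _ ≤ ∑ p ∈ I, F := by
          refine Finset.sum_le_sum fun p hp => ?_
          rw [hI, Finset.mem_product, Finset.mem_powersetCard, Finset.mem_powersetCard] at hp
          have h2 := card_agree_mul_le (r := r) p.1 p.2 (Finset.card_pos.1 (by omega))
          rw [hp.1.2, hp.2.2] at h2
          exact h2
      _ = I.card * F := by rw [Finset.sum_const, smul_eq_mul]
      _ ≤ (u * m) ^ K * F := by gcongr
  -- The union bound succeeds: fewer pairs `(X, B)` than the inverse of the probability that one is
  -- bad.
  have h2 : (u * m) ^ K < r ^ (K * (K - 1)) := by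
    rw [mul_comm K, pow_mul]
    exact Nat.pow_lt_pow_left h hK.ne'
  have h3 : (u * m) ^ K * F < r ^ (K * (K - 1)) * F := by gcongr
  linarith

/-- The words that have the letter `s.2` at the coordinate `s.1`. -/
def wordsWith {u m r : ℕ} (f : Fin u → Fin m → Fin r) (s : Fin m × Fin r) : Finset (Fin u) :=
  Finset.univ.filter fun x => f x s.1 = s.2

theorem mem_wordsWith {u m r : ℕ} {f : Fin u → Fin m → Fin r} {s : Fin m × Fin r} {x : Fin u} :
    x ∈ wordsWith f s ↔ f x s.1 = s.2 := by
  simp [wordsWith]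

/-- If any `K` words agree in fewer than `K` coordinates, then `K` words are shared by at most `K ^ 2`
of the pairwise intersections of the sets `wordsWith f s`. -/
theorem card_pairs_le {u m r K : ℕ} (hK : 0 < K) {f : Fin u → Fin m → Fin r} {X : Finset (Fin u)}
    (hX : X.card = K)
    (hf : ∀ B : Finset (Fin m), (∀ b ∈ B, ∀ x ∈ X, ∀ y ∈ X, f x b = f y b) → B.card < K)
    (J : Finset ((Fin m × Fin r) × (Fin m × Fin r)))
    (hJ : ∀ q ∈ J, X ⊆ wordsWith f q.1 ∩ wordsWith f q.2) : J.card ≤ K ^ 2 := by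
  classical
  obtain ⟨x₀, hx₀⟩ : X.Nonempty := Finset.card_pos.1 (by omega)
  set B := Finset.univ.filter fun b : Fin m => ∀ x ∈ X, ∀ y ∈ X, f x b = f y b with hB
  have hBK : B.card < K := hf B fun b hb => (Finset.mem_filter.1 hb).2
  have key : ∀ q ∈ J, ∀ x ∈ X, f x q.1.1 = q.1.2 ∧ f x q.2.1 = q.2.2 := by
    intro q hq x hx
    have := hJ q hq hx
    rwa [Finset.mem_inter, mem_wordsWith, mem_wordsWith] at this
  calc J.card ≤ (B ×ˢ B).card := by
        -- The two coordinates determine the query, since its letters are read off from the word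
        -- `x₀`.
        refine Finset.card_le_card_of_injOn (fun q => (q.1.1, q.2.1)) ?_ ?_
        · intro q hq
          have hq := key q hq
          simp only [hB, Finset.coe_product, Set.mem_prod, Finset.mem_coe, Finset.mem_filter,
            Finset.mem_univ, true_and]
          exact ⟨fun x hx y hy => (hq x hx).1.trans (hq y hy).1.symm,
            fun x hx y hy => (hq x hx).2.trans (hq y hy).2.symm⟩
        · rintro ⟨⟨b, v⟩, ⟨b', v'⟩⟩ hq ⟨⟨c, w⟩, ⟨c', w'⟩⟩ hp heq
          have h1 := key _ hq x₀ hx₀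
          have h2 := key _ hp x₀ hx₀
          simp only [Prod.mk.injEq] at heq h1 h2 ⊢
          obtain ⟨rfl, rfl⟩ := heq
          exact ⟨⟨rfl, h1.1.symm.trans h2.1⟩, rfl, h1.2.symm.trans h2.2⟩
    _ ≤ K ^ 2 := by
        rw [Finset.card_product, sq]
        gcongr

/-- The pairwise intersections of size at least the half of the average carry half of the total
size. -/
theorem le_sum_card_inter {u m r : ℕ} (hr : 0 < r) (f : Fin u → Fin m → Fin r) :
    (u : ℝ) * m ^ 2 / 2 ≤ ((∑ q ∈ Finset.univ.filter
      (fun q : (Fin m × Fin r) × (Fin m × Fin r) =>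
        (u : ℝ) / (2 * r ^ 2) ≤ ((wordsWith f q.1 ∩ wordsWith f q.2).card : ℝ)),
      (wordsWith f q.1 ∩ wordsWith f q.2).card : ℕ) : ℝ) := by
  classical
  set R := fun q : (Fin m × Fin r) × (Fin m × Fin r) => wordsWith f q.1 ∩ wordsWith f q.2 with hR
  have htotal : ∑ q, (R q).card = u * m ^ 2 := by
    have h1 : ∀ q, (R q).card = (Finset.univ.filter fun x => x ∈ R q).card := by
      intro q; simp
    rw [Finset.sum_congr rfl fun q _ => h1 q]
    have h2 := Finset.sum_card_bipartiteAbove_eq_sum_card_bipartiteBelow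
      (s := (Finset.univ : Finset ((Fin m × Fin r) × (Fin m × Fin r))))
      (t := (Finset.univ : Finset (Fin u))) (fun q x => x ∈ R q)
    refine h2.trans ?_
    -- A word lies in exactly one intersection for each pair of coordinates.
    have h3 : ∀ x : Fin u, (Finset.bipartiteBelow (fun q x => x ∈ R q) Finset.univ x).card =
        m ^ 2 := by
      intro x
      have : Finset.bipartiteBelow (fun q x => x ∈ R q) Finset.univ x =
          (Finset.univ : Finset (Fin m × Fin m)).image
            fun b => ((b.1, f x b.1), (b.2, f x b.2)) := by
        ext ⟨⟨b, v⟩, ⟨b', v'⟩⟩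
        simp [Finset.bipartiteBelow, hR, mem_wordsWith]
      rw [this, Finset.card_image_of_injective]
      · simp [sq]
      · rintro ⟨b, b'⟩ ⟨c, c'⟩ h
        simp only [Prod.mk.injEq] at h ⊢
        exact ⟨h.1.1, h.2.1⟩
    rw [Finset.sum_congr rfl fun x _ => h3 x]
    simp
  have hsplit := Finset.sum_filter_add_sum_filter_not Finset.univ
    (fun q => (u : ℝ) / (2 * r ^ 2) ≤ ((R q).card : ℝ)) (fun q => ((R q).card : ℝ))
  have hsmall : ∑ q ∈ Finset.univ.filter (fun q => ¬ (u : ℝ) / (2 * r ^ 2) ≤ ((R q).card : ℝ)),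
      ((R q).card : ℝ) ≤ (m * r) ^ 2 * ((u : ℝ) / (2 * r ^ 2)) := by
    refine (Finset.sum_le_card_nsmul _ _ ((u : ℝ) / (2 * r ^ 2)) fun q hq => ?_).trans ?_
    · exact (not_le.1 (Finset.mem_filter.1 hq).2).le
    · rw [nsmul_eq_mul]
      gcongr
      have h1 := Finset.card_le_univ
        (Finset.univ.filter (fun q => ¬ (u : ℝ) / (2 * r ^ 2) ≤ ((R q).card : ℝ)))
      simp only [Fintype.card_prod, Fintype.card_fin] at h1
      calc _ ≤ ((m * r * (m * r) : ℕ) : ℝ) := by exact_mod_cast h1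
        _ = _ := by push_cast; ring
  have htotal' : ∑ q, ((R q).card : ℝ) = u * m ^ 2 := by exact_mod_cast htotal
  have hr' : (r : ℝ) ≠ 0 := by positivity
  have h4 : ((m : ℝ) * r) ^ 2 * ((u : ℝ) / (2 * r ^ 2)) = u * m ^ 2 / 2 := by
    field_simp
  push_cast
  linarith

/-! ### Encoding symbols as strings over two letters -/

section Encoding

variable {A : Type} (a b : A)

/-- A binary string with the letter `a` before, between and after its letters. -/
def spacedWord : List Bool → List A
  | [] => [a]
  | x :: xs => a :: (if x then b else a) :: spacedWord xs

/-- A code word: the marker `bbb` followed by a spaced binary string. -/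
def codeWord (w : List Bool) : List A := b :: b :: b :: spacedWord a b w

theorem length_spacedWord (w : List Bool) : (spacedWord a b w).length = 2 * w.length + 1 := by
  induction w with
  | nil => rfl
  | cons x xs ih => simp [spacedWord, ih]; ring

theorem length_codeWord (w : List Bool) : (codeWord a b w).length = 2 * w.length + 4 := by
  simp [codeWord, length_spacedWord]

theorem exists_spacedWord_eq_cons (w : List Bool) : ∃ t, spacedWord a b w = a :: t := by
  cases w <;> simp [spacedWord]

variable {a b}

theorem spacedWord_injective (hab : a ≠ b) : Function.Injective (spacedWord a b) := by
  intro w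
  induction w with
  | nil =>
    intro w' h
    have := congrArg List.length h
    rw [length_spacedWord, length_spacedWord] at this
    exact (List.length_eq_zero_iff.1 (by simpa using this.symm)).symm
  | cons x xs ih =>
    intro w' h
    cases w' with
    | nil => simp [spacedWord] at h
    | cons y ys =>
      simp only [spacedWord, List.cons.injEq, true_and] at h
      rw [ih h.2]
      cases x <;> cases y <;> simp_all

theorem codeWord_injective (hab : a ≠ b) : Function.Injective (codeWord a b) := by
  intro w w' h
  simp only [codeWord, List.cons.injEq, true_and] at h
  exact spacedWord_injective hab h

/-- In a spaced word every `b` is followed by an `a`, and the last letter is `a`, so no `bb` starts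
inside it. -/
theorem infix_of_infix_spacedWord_append (hab : a ≠ b) (p rest : List A) (w : List Bool)
    (h : b :: b :: p <:+: spacedWord a b w ++ rest) : b :: b :: p <:+: rest := by
  induction w with
  | nil =>
    rw [spacedWord, List.singleton_append, List.infix_cons_iff] at h
    rcases h with h | h
    · exact absurd (List.cons_prefix_cons.1 h).1.symm hab
    · exact h
  | cons x xs ih =>
    rw [spacedWord, List.cons_append, List.cons_append, List.infix_cons_iff,
      List.infix_cons_iff] at h
    rcases h with h | h | h
    · exact absurd (List.cons_prefix_cons.1 h).1.symm hab
    · obtain ⟨t, ht⟩ := exists_spacedWord_eq_cons a b xs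
      rw [ht, List.cons_append] at h
      exact absurd (List.cons_prefix_cons.1 (List.cons_prefix_cons.1 h).2).1.symm hab
    · exact ih h

/-- A code word occurs in a concatenation of code words, followed by padding, only if it is one of
them. -/
theorem codeWord_infix_iff (hab : a ≠ b) {l k : ℕ} {w : List Bool} (hw : w.length = l)
    (ws : List (List Bool)) (hws : ∀ x ∈ ws, x.length = l) :
    codeWord a b w <:+: ws.flatMap (codeWord a b) ++ List.replicate k a ↔ w ∈ ws := by
  constructor
  · intro h
    induction ws with
    | nil =>
      have hb : b ∈ List.replicate k a := by
        have : b ∈ codeWord a b w := by simp [codeWord]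
        simpa using h.subset this
      exact absurd (List.eq_of_mem_replicate hb).symm hab
    | cons x xs ih =>
      rw [List.flatMap_cons, List.append_assoc] at h
      obtain ⟨t, ht⟩ := exists_spacedWord_eq_cons a b x
      have h' := h
      rw [codeWord.eq_def a b x, List.cons_append, List.cons_append, List.cons_append,
        List.infix_cons_iff, List.infix_cons_iff, List.infix_cons_iff] at h'
      -- An occurrence starts at one of the three marker letters or later. At the first, equal
      -- lengths force equal code words; at the second or third, its `bbb` would meet the initial
      -- `a` of the spaced word.
      rcases h' with h' | h' | h' | h'
      · have h1 : codeWord a b w <+: codeWord a b x ++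
            (xs.flatMap (codeWord a b) ++ List.replicate k a) := h'
        have hlen : (codeWord a b w).length = (codeWord a b x).length := by
          rw [length_codeWord, length_codeWord, hw, hws x (by simp)]
        have h2 := (List.prefix_of_prefix_length_le h1 (List.prefix_append _ _) hlen.le).eq_of_length
          hlen
        simp [codeWord_injective hab h2]
      · rw [codeWord, ht] at h'
        simp only [List.cons_append, List.cons_prefix_cons, true_and] at h'
        exact absurd h'.1.symm hab
      · rw [codeWord, ht] at h'
        simp only [List.cons_append, List.cons_prefix_cons, true_and] at h'
        exact absurd h'.1.symm hab
      · exact List.mem_cons_of_mem _ (ih (fun y hy => hws y (by simp [hy]))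
          (infix_of_infix_spacedWord_append hab _ _ _ h'))
  · intro h
    obtain ⟨s, t, rfl⟩ := List.append_of_mem h
    rw [List.flatMap_append, List.flatMap_cons]
    exact ⟨s.flatMap (codeWord a b), t.flatMap (codeWord a b) ++ List.replicate k a, by simp⟩

end Encoding

/-! ### Hard instances of the four problems -/

/-- Every family of words has inputs of every sufficiently large size in which the pairwise
intersections of the sets `wordsWith f s` are the answers to queries with short patterns. -/
def ReportingProblem.HasWordInstances (P : ReportingProblem) : Prop :=
  ∀ (l u m r n : ℕ) (f : Fin u → Fin m → Fin r), 0 < u → 0 < m → 2 * (m * r) ≤ 2 ^ l →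
    u * (m * r * (2 * l + 4)) ≤ n →
    ∃ I : P.Input, P.size I = n ∧ ∃ (e : Fin u ↪ P.Elem I)
      (q : Fin m × Fin r → Fin m × Fin r → P.Query I), ∀ s s',
        P.queryLength I (q s s') ≤ 2 * (2 * l + 4) ∧
        P.answer I (q s s') = (wordsWith f s ∩ wordsWith f s').map e

/-- Documents that encode words, with patterns `p s true` and `p s false` that occur in exactly the
documents in, respectively not in, `wordsWith f s`. -/
theorem exists_documentCollection (A : Type) [Nontrivial A] {l u m r n : ℕ}
    (f : Fin u → Fin m → Fin r) (hu : 0 < u) (hm : 0 < m) (hl : 2 * (m * r) ≤ 2 ^ l)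
    (hn : u * (m * r * (2 * l + 4)) ≤ n) :
    ∃ doc : Fin u → List A, (∀ x, doc x ≠ []) ∧ ∑ x, (doc x).length = n ∧
      ∃ p : Fin m × Fin r → Bool → Pattern A, (∀ s β, (p s β).1.length = 2 * l + 4) ∧
        ∀ s β x, (p s β).OccursIn (doc x) ↔ β = decide (f x s.1 = s.2) := by
  classical
  obtain ⟨a, b, hab⟩ := exists_pair_ne A
  have hr : 0 < r := (f ⟨0, hu⟩ ⟨0, hm⟩).pos
  obtain ⟨enc⟩ : Nonempty ((Fin m × Fin r) × Bool ↪ (Fin l → Bool)) := by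
    refine Function.Embedding.nonempty_of_card_le ?_
    simp only [Fintype.card_prod, Fintype.card_fin, Fintype.card_bool, Fintype.card_fun]
    omega
  let bits : (Fin m × Fin r) → Bool → List Bool := fun s β => List.ofFn (enc (s, β))
  have hbits : ∀ s β, (bits s β).length = l := fun s β => by simp [bits]
  -- Each document lists one of two code words for every symbol, according to whether its word has
  -- that symbol. Absence of one is presence of the other, which handles forbidden patterns.
  let ws : Fin u → List (List Bool) := fun x =>
    (Finset.univ : Finset (Fin m × Fin r)).toList.map fun s => bits s (decide (f x s.1 = s.2))
  have hws : ∀ x, ∀ w ∈ ws x, w.length = l := by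
    intro x w hw
    obtain ⟨s, -, rfl⟩ := List.mem_map.1 hw
    exact hbits _ _
  have hmem : ∀ x s β, bits s β ∈ ws x ↔ β = decide (f x s.1 = s.2) := by
    intro x s β
    constructor
    · intro h
      obtain ⟨s', -, hs'⟩ := List.mem_map.1 h
      have := enc.injective (List.ofFn_injective hs')
      simp only [Prod.mk.injEq] at this
      obtain ⟨rfl, rfl⟩ := this
      rfl
    · rintro rfl
      exact List.mem_map.2 ⟨s, by simp, rfl⟩
  have hlenws : ∀ x, ((ws x).flatMap (codeWord a b)).length = m * r * (2 * l + 4) := by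
    intro x
    rw [List.length_flatMap, List.map_congr_left (g := fun _ => 2 * l + 4)
      (fun w hw => by rw [length_codeWord, hws x w hw])]
    simp [ws]
  -- One document absorbs the padding that makes the total length exactly `n`.
  let pad : Fin u → ℕ := fun x =>
    if x = ⟨0, hu⟩ then n - u * (m * r * (2 * l + 4)) else 0
  refine ⟨fun x => (ws x).flatMap (codeWord a b) ++ List.replicate (pad x) a, fun x hx => ?_, ?_,
    fun s β => ⟨codeWord a b (bits s β), by simp [codeWord]⟩, fun s β => ?_, fun s β x => ?_⟩
  · have := congrArg List.length hx
    rw [List.length_append, hlenws, List.length_nil] at this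
    have h0 : 0 < m * r * (2 * l + 4) := by positivity
    omega
  · simp only [List.length_append, hlenws, List.length_replicate, Finset.sum_add_distrib, pad]
    simp only [Finset.sum_const, Finset.card_univ, Fintype.card_fin, smul_eq_mul,
      Finset.sum_ite_eq', Finset.mem_univ, if_true]
    omega
  · simp [length_codeWord, hbits]
  · rw [Pattern.OccursIn, codeWord_infix_iff hab (hbits s β) _ (hws x), hmem]

theorem documentProblem_hasWordInstances (A : Type) [Nontrivial A]
    (isMatch : Pattern A → Pattern A → List A → Prop) (β₁ β₂ : Bool)
    (h : ∀ p₁ p₂ d, isMatch p₁ p₂ d ↔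
      (p₁.OccursIn d ↔ β₁ = true) ∧ (p₂.OccursIn d ↔ β₂ = true)) :
    (documentProblem A isMatch).HasWordInstances := by
  classical
  intro l u m r n f hu hm hl hn
  obtain ⟨doc, hne, hsum, p, hlen, hp⟩ := exists_documentCollection A f hu hm hl hn
  refine ⟨⟨u, doc, hne⟩, hsum, Function.Embedding.refl _, fun s s' => (p s β₁, p s' β₂),
    fun s s' => ⟨?_, ?_⟩⟩
  · change (p s β₁).1.length + (p s' β₂).1.length ≤ _
    rw [hlen, hlen]
    omega
  · change (Finset.univ.filter fun i : Fin u => isMatch (p s β₁) (p s' β₂) (doc i)) =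
      (wordsWith f s ∩ wordsWith f s').map (Function.Embedding.refl (Fin u))
    rw [Finset.map_refl]
    ext x
    rw [Finset.mem_inter, mem_wordsWith, mem_wordsWith, Finset.mem_filter, h, hp, hp]
    cases β₁ <;> cases β₂ <;> simp

theorem twoPattern_hasWordInstances (A : Type) [Nontrivial A] :
    (twoPattern A).HasWordInstances :=
  documentProblem_hasWordInstances A _ true true (by simp)

theorem forbiddenPattern_hasWordInstances (A : Type) [Nontrivial A] :
    (forbiddenPattern A).HasWordInstances :=
  documentProblem_hasWordInstances A _ true false (by simp)

theorem twoForbiddenPatterns_hasWordInstances (A : Type) [Nontrivial A] :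
    (twoForbiddenPatterns A).HasWordInstances :=
  documentProblem_hasWordInstances A _ false false (by simp)

theorem sum_card_wordsWith {u m r : ℕ} (f : Fin u → Fin m → Fin r) :
    ∑ s, (wordsWith f s).card = u * m := by
  classical
  simp only [wordsWith, Finset.card_filter, Fintype.sum_prod_type]
  rw [Finset.sum_congr rfl fun b _ => Finset.sum_comm]
  simp [mul_comm]

theorem setIntersection_hasWordInstances : setIntersection.HasWordInstances := by
  classical
  intro l u m r n f hu hm hl hn
  have hr : 0 < r := (f ⟨0, hu⟩ ⟨0, hm⟩).pos
  have hum : u * m ≤ n := by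
    refine le_trans (Nat.mul_le_mul_left u ?_) hn
    calc m = m * 1 * 1 := by simp
      _ ≤ m * r * (2 * l + 4) := by gcongr <;> omega
  have hun : u ≤ n := (Nat.le_mul_of_pos_right u hm).trans hum
  obtain ⟨Z, -, hZ⟩ := Finset.exists_subset_card_eq (s := (Finset.univ : Finset (Fin n)))
    (n := n - u * m) (by simp)
  -- The extra set `Z`, never queried, brings the total size to exactly `n`.
  let sets : Fin (m * r + 1) → Finset (Fin n) := Fin.lastCases Z
    fun j => (wordsWith f (finProdFinEquiv.symm j)).map (Fin.castLEEmb hun)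
  have hsets : ∀ s, sets (finProdFinEquiv s).castSucc = (wordsWith f s).map (Fin.castLEEmb hun) := by
    intro s
    simp only [sets, Fin.lastCases_castSucc, Equiv.symm_apply_apply]
  refine ⟨⟨n, m * r + 1, sets⟩, ?_, Fin.castLEEmb hun,
    fun s s' => ((finProdFinEquiv s).castSucc, (finProdFinEquiv s').castSucc),
    fun s s' => ⟨Nat.zero_le _, ?_⟩⟩
  · change ∑ i, (sets i).card = n
    rw [Fin.sum_univ_castSucc, ← Equiv.sum_comp finProdFinEquiv]
    simp only [hsets, Finset.card_map, sum_card_wordsWith]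
    simp only [sets, Fin.lastCases_last, hZ]
    omega
  · change sets (finProdFinEquiv s).castSucc ∩ sets (finProdFinEquiv s').castSucc = _
    rw [hsets, hsets]
    exact (Finset.map_inter _ _).symm

/-! ### Space bounds for reporting problems -/

theorem PointerMachine.Reports.mono {U : Type} {G : PointerMachine U} {R : Finset U} {T T' : ℝ}
    (h : G.Reports R T) (hT : T ≤ T') : G.Reports R T' := by
  obtain ⟨W, hW, hR, hc⟩ := h
  exact ⟨W, hW, hR, hc.trans hT⟩

/-- On inputs of size `n` there are data structures with space `s` that answer every query with at
least `τ` results in time at most `c` times the size of the query and its answer. -/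
def ReportingProblem.ReportsLargeAnswers (P : ReportingProblem) (n : ℕ) (s τ c : ℝ) : Prop :=
  ∀ I : P.Input, P.size I = n → ∃ G : PointerMachine (P.Elem I), (G.size : ℝ) ≤ s ∧
    ∀ q : P.Query I, τ ≤ ((P.answer I q).card : ℝ) →
      G.Reports (P.answer I q) (c * ((P.queryLength I q : ℝ) + ((P.answer I q).card : ℝ)))

/-- The constant lost in the pointer-machine argument. -/
def machineConstant (K C : ℕ) : ℕ :=
  2 ^ (2 * (K * C) + 2) * ((2 ^ (2 * (K * C) + 2)) ^ K * K ^ 2)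

theorem machineConstant_pos {K : ℕ} (hK : 0 < K) (C : ℕ) : 0 < machineConstant K C := by
  unfold machineConstant
  positivity

namespace ReportingProblem

variable {P : ReportingProblem}

/-- The counting bound applied to the intersections of at least half the average size, which carry
half of the total. The threshold `u / (2 * r ^ 2)` must dominate `τ`, the query length and the depth
requirement of `sum_card_le_size`. -/
theorem HasWordInstances.le_space (hP : P.HasWordInstances) {K C l u m r n : ℕ} {s τ c : ℝ}
    (hK : 0 < K) (hu : 0 < u) (hm : 0 < m) (hr : 0 < r) (hl : 2 * (m * r) ≤ 2 ^ l)
    (hn : u * (m * r * (2 * l + 4)) ≤ n) (hum : u * m < r ^ (K - 1)) (hc : 0 ≤ c)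
    (hC : 2 * c ≤ C) (hτ : τ ≤ (u : ℝ) / (2 * r ^ 2))
    (hlen : ((2 * (2 * l + 4) : ℕ) : ℝ) ≤ (u : ℝ) / (2 * r ^ 2))
    (hlarge : ((2 ^ (2 * (K * C) + 3) : ℕ) : ℝ) ≤ (u : ℝ) / (2 * r ^ 2))
    (hDS : P.ReportsLargeAnswers n s τ c) :
    (u : ℝ) * m ^ 2 / 2 ≤ machineConstant K C * s := by
  classical
  obtain ⟨f, hf⟩ := exists_words_agree_lt hr hK hum
  obtain ⟨I, hI, e, q, hq⟩ := hP l u m r n f hu hm hl hn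
  obtain ⟨G, hGs, hG⟩ := hDS I hI
  set J := Finset.univ.filter (fun p : (Fin m × Fin r) × (Fin m × Fin r) =>
    (u : ℝ) / (2 * r ^ 2) ≤ ((wordsWith f p.1 ∩ wordsWith f p.2).card : ℝ)) with hJ
  have hcard : ∀ p : (Fin m × Fin r) × (Fin m × Fin r), (P.answer I (q p.1 p.2)).card =
      (wordsWith f p.1 ∩ wordsWith f p.2).card := fun p => by
    rw [(hq p.1 p.2).2, Finset.card_map]
  have hJcard : ∀ p ∈ J, (u : ℝ) / (2 * r ^ 2) ≤ ((P.answer I (q p.1 p.2)).card : ℝ) := by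
    intro p hp
    rw [hcard]
    exact (Finset.mem_filter.1 hp).2
  have hmain := G.sum_card_le_size J (fun p => P.answer I (q p.1 p.2)) (K := K) (C := C)
    (N := K ^ 2) (h := 2 * (K * C) + 1) rfl ?_ ?_ ?_
  · have h1 := le_sum_card_inter hr f
    rw [← Finset.sum_congr rfl fun p _ => hcard p] at h1
    calc (u : ℝ) * m ^ 2 / 2 ≤ _ := h1
      _ ≤ ((machineConstant K C * G.size : ℕ) : ℝ) := Nat.cast_le.2 hmain
      _ = machineConstant K C * (G.size : ℝ) := by push_cast; ring
      _ ≤ machineConstant K C * s := by gcongr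
  · intro p hp
    exact_mod_cast hlarge.trans (hJcard p hp)
  · intro p hp
    refine (hG _ (hτ.trans (hJcard p hp))).mono ?_
    have h1 : (P.queryLength I (q p.1 p.2) : ℝ) ≤ ((P.answer I (q p.1 p.2)).card : ℝ) :=
      (Nat.cast_le.2 (hq p.1 p.2).1).trans (hlen.trans (hJcard p hp))
    push_cast
    calc _ ≤ c * (((P.answer I (q p.1 p.2)).card : ℝ) + ((P.answer I (q p.1 p.2)).card : ℝ)) := by
          gcongr
      _ = 2 * c * ((P.answer I (q p.1 p.2)).card : ℝ) := by ring
      _ ≤ _ := by gcongr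
  · intro X hX J' hJ' hXJ
    -- Only a nonempty `J'` guarantees that `X` consists of images of words under `e`.
    rcases J'.eq_empty_or_nonempty with rfl | ⟨p₀, hp₀⟩
    · simp
    · have h0 := hXJ p₀ hp₀
      simp only [(hq _ _).2] at h0
      obtain ⟨X', -, rfl⟩ := Finset.subset_map_iff.1 h0
      rw [Finset.card_map] at hX
      refine card_pairs_le hK hX (hf X' hX) J' fun p hp => ?_
      have h1 := hXJ p hp
      simp only [(hq _ _).2] at h1
      exact Finset.map_subset_map.1 h1

/-- The space is at least linear, since every element has to be stored. -/
theorem HasWordInstances.div_le_space (hP : P.HasWordInstances) {n : ℕ} (hn : 12 ≤ n) {s : ℝ}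
    (hDS : ∀ I : P.Input, P.size I = n → ∃ G : PointerMachine (P.Elem I), (G.size : ℝ) ≤ s ∧
      ∀ q : P.Query I, ∃ T, G.Reports (P.answer I q) T) : (n : ℝ) / 12 ≤ s := by
  classical
  -- A single symbol shared by all `n / 6` words, whose code words have length `2 * 1 + 4 = 6`.
  obtain ⟨I, hI, e, q, hq⟩ := hP 1 (n / 6) 1 1 n (fun _ _ => 0) (by omega) one_pos (by norm_num)
    (by omega)
  obtain ⟨G, hGs, hG⟩ := hDS I hI
  obtain ⟨T, hT⟩ := hG (q 0 0)
  have h1 := G.card_le_size_of_reports hT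
  rw [(hq 0 0).2, Finset.card_map] at h1
  have h2 : wordsWith (fun (_ : Fin (n / 6)) (_ : Fin 1) => (0 : Fin 1)) 0 = Finset.univ := by
    ext x
    simp [mem_wordsWith]
  rw [h2, Finset.inter_self, Finset.card_univ, Fintype.card_fin] at h1
  have h3 : n ≤ 12 * G.size := by omega
  have h4 : (n : ℝ) ≤ 12 * G.size := by exact_mod_cast h3
  linarith

end ReportingProblem

/-! ### Choice of parameters -/

theorem eventually_log_le_rpow {δ : ℝ} (hδ : 0 < δ) :
    ∀ᶠ n : ℕ in atTop, ((2 * (2 * (Nat.log 2 n + 2) + 4) : ℕ) : ℝ) ≤ (n : ℝ) ^ δ := by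
  have h1 := (isLittleO_log_rpow_atTop hδ).bound (c := Real.log 2 / 8) (by positivity)
  have h2 := tendsto_natCast_atTop_atTop.eventually h1
  have h3 := ((tendsto_rpow_atTop hδ).comp tendsto_natCast_atTop_atTop).eventually_ge_atTop
    (32 : ℝ)
  filter_upwards [h2, h3, eventually_ge_atTop 1] with n hn hn' hn1
  have h4 : (Nat.log 2 n : ℝ) ≤ Real.log n / Real.log 2 := by
    simpa [Real.logb] using Real.natLog_le_logb n 2
  simp only [Function.comp] at hn'
  have hlog : 0 < Real.log 2 := Real.log_pos (by norm_num)
  rw [Real.norm_eq_abs, Real.norm_eq_abs, abs_of_nonneg (by positivity : (0 : ℝ) ≤ (n : ℝ) ^ δ)] at hn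
  have h5 : Real.log n / Real.log 2 ≤ (n : ℝ) ^ δ / 8 := by
    rw [div_le_iff₀ hlog]
    linarith [le_abs_self (Real.log n)]
  push_cast
  linarith

theorem eventually_const_le_rpow (D : ℝ) {δ : ℝ} (hδ : 0 < δ) :
    ∀ᶠ n : ℕ in atTop, D ≤ (n : ℝ) ^ δ :=
  ((tendsto_rpow_atTop hδ).comp tendsto_natCast_atTop_atTop).eventually_ge_atTop D

/-- The dimensions of the words used in an input of size `n`. -/
theorem exists_word_dimensions {x τ : ℝ} {n l : ℕ} (hx32 : 32 ≤ x) (hτ1 : 1 ≤ τ)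
    (hℓ : ((2 * l + 4 : ℕ) : ℝ) ≤ x) (hn : x ^ 6 * τ ≤ n) :
    ∃ u m r : ℕ, 0 < u ∧ 0 < m ∧ 0 < r ∧ x ≤ r ∧ u * (m * r * (2 * l + 4)) ≤ n ∧
      τ * x ≤ (u : ℝ) / (2 * r ^ 2) ∧ (n : ℝ) ^ 2 ≤ u * m ^ 2 * (256 * x ^ 7 * τ) := by
  have hx0 : 0 < x := by linarith
  obtain ⟨r, hr⟩ : ∃ r, r = ⌈x⌉₊ := ⟨_, rfl⟩
  have hxr : x ≤ r := hr ▸ Nat.le_ceil x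
  have hr2 : (r : ℝ) ≤ 2 * x := by
    rw [hr]
    linarith [Nat.ceil_lt_add_one hx0.le]
  have hr1 : (1 : ℝ) ≤ r := by linarith
  have hr0 : 0 < r := by exact_mod_cast (by linarith : (0 : ℝ) < r)
  -- Chosen so that half the average intersection is at least `τ * x`; the factor `x` absorbs query
  -- lengths and constants.
  obtain ⟨y, hy⟩ : ∃ y : ℝ, y = 2 * (r : ℝ) ^ 2 * τ * x := ⟨_, rfl⟩
  have hy1 : 1 ≤ y := by
    have h2 : (1 : ℝ) ≤ r ^ 2 := one_le_pow₀ hr1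
    calc (1 : ℝ) = 1 * 1 * 1 * 1 := by norm_num
      _ ≤ 2 * (r : ℝ) ^ 2 * τ * x := by gcongr <;> linarith
      _ = y := hy.symm
  obtain ⟨u, hu⟩ : ∃ u, u = ⌈y⌉₊ := ⟨_, rfl⟩
  have hul : y ≤ u := hu ▸ Nat.le_ceil _
  have hu0 : 0 < u := by exact_mod_cast (by linarith : (0 : ℝ) < u)
  have huu : (u : ℝ) ≤ 16 * x ^ 3 * τ := by
    have h1 := Nat.ceil_lt_add_one (by linarith : 0 ≤ y)
    rw [← hu] at h1
    calc (u : ℝ) ≤ 2 * (2 * (r : ℝ) ^ 2 * τ * x) := by linarith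
      _ ≤ 2 * (2 * (2 * x) ^ 2 * τ * x) := by gcongr
      _ = 16 * x ^ 3 * τ := by ring
  obtain ⟨B, hB⟩ : ∃ B, B = u * r * (2 * l + 4) := ⟨_, rfl⟩
  have hB0 : 0 < B := by rw [hB]; positivity
  have hBx : (B : ℝ) ≤ n := by
    calc (B : ℝ) = u * r * ((2 * l + 4 : ℕ) : ℝ) := by rw [hB]; push_cast; ring
      _ ≤ (16 * x ^ 3 * τ) * (2 * x) * x := by gcongr
      _ = 32 * (x ^ 5 * τ) := by ring
      _ ≤ x * (x ^ 5 * τ) := by gcongr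
      _ = x ^ 6 * τ := by ring
      _ ≤ n := hn
  obtain ⟨m, hm⟩ : ∃ m, m = n / B := ⟨_, rfl⟩
  have hm0 : 0 < m := hm ▸ Nat.div_pos (by exact_mod_cast hBx) hB0
  have hmB : m * B ≤ n := hm ▸ Nat.div_mul_le_self n B
  have hnm : n ≤ 2 * m * B := by
    have h1 := Nat.lt_div_mul_add (a := n) hB0
    have h2 : B ≤ m * B := Nat.le_mul_of_pos_left B hm0
    rw [← hm] at h1
    linarith
  refine ⟨u, m, r, hu0, hm0, hr0, hxr, ?_, ?_, ?_⟩
  · calc u * (m * r * (2 * l + 4)) = m * B := by rw [hB]; ring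
      _ ≤ n := hmB
  · rw [le_div_iff₀ (by positivity)]
    linarith
  · have h1 : (n : ℝ) ≤ 2 * m * B := by exact_mod_cast hnm
    calc (n : ℝ) ^ 2 ≤ (2 * m * B) ^ 2 := by gcongr
      _ = u * m ^ 2 * (4 * u * r ^ 2 * ((2 * l + 4 : ℕ) : ℝ) ^ 2) := by
        rw [hB]; push_cast; ring
      _ ≤ u * m ^ 2 * (4 * (16 * x ^ 3 * τ) * (2 * x) ^ 2 * x ^ 2) := by gcongr
      _ = _ := by ring

/-- The quantitative form of the lower bound, for thresholds `τ` that are not too large. -/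
theorem ReportingProblem.HasWordInstances.eventually_rpow_le {P : ReportingProblem}
    (hP : P.HasWordInstances) {c : ℝ} (hc : 0 ≤ c) {δ : ℝ} (hδ : 0 < δ) :
    ∀ᶠ n : ℕ in atTop, ∀ s τ : ℝ, 1 ≤ τ → τ ≤ (n : ℝ) ^ (1 - 6 * δ) →
      P.ReportsLargeAnswers n s τ c → (n : ℝ) ^ (2 - 8 * δ) ≤ s * τ := by
  obtain ⟨C, hC⟩ := exists_nat_ge (2 * c)
  -- Makes `r ^ (K - 1) ≥ n ^ (δ * (K - 1)) > n ≥ u * m`, as the random words require; `K` is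
  -- independent of `n`.
  obtain ⟨K, hK, hKδ⟩ : ∃ K : ℕ, 0 < K ∧ 1 / δ < ((K - 1 : ℕ) : ℝ) := by
    obtain ⟨k, hk⟩ := exists_nat_gt (1 / δ)
    exact ⟨k + 1, k.succ_pos, by simpa using hk⟩
  obtain ⟨M, hM⟩ : ∃ M, M = machineConstant K C := ⟨_, rfl⟩
  have hMpos : (0 : ℝ) < M := by rw [hM]; exact_mod_cast machineConstant_pos hK C
  filter_upwards [eventually_log_le_rpow hδ, eventually_ge_atTop 2,
    eventually_const_le_rpow ((2 ^ (2 * (K * C) + 3) : ℕ) : ℝ) hδ,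
    eventually_const_le_rpow (512 * M) hδ, eventually_const_le_rpow 32 hδ]
    with n hlog hn2 hlarge hMx hx32 s τ hτ1 hτ hDS
  obtain ⟨x, hx⟩ : ∃ x : ℝ, x = (n : ℝ) ^ δ := ⟨_, rfl⟩
  rw [← hx] at hlog hlarge hMx hx32
  have hn1 : (1 : ℝ) < n := by exact_mod_cast hn2
  have hn0 : (0 : ℝ) < n := by linarith
  have hx0 : 0 < x := by linarith
  have hxpow : ∀ k : ℕ, x ^ k = (n : ℝ) ^ (k * δ) := by
    intro k
    rw [hx, ← Real.rpow_natCast, ← Real.rpow_mul hn0.le, mul_comm]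
  obtain ⟨l, hl⟩ : ∃ l, l = Nat.log 2 n + 2 := ⟨_, rfl⟩
  rw [← hl] at hlog
  have hℓ : ((2 * l + 4 : ℕ) : ℝ) ≤ x :=
    le_trans (Nat.cast_le.2 (by omega : 2 * l + 4 ≤ 2 * (2 * l + 4))) hlog
  have hx6 : x ^ 6 * τ ≤ n := by
    calc x ^ 6 * τ ≤ x ^ 6 * (n : ℝ) ^ (1 - 6 * δ) := by gcongr
      _ = (n : ℝ) := by
        rw [hxpow, ← Real.rpow_add hn0]
        norm_num
  obtain ⟨u, m, r, hu0, hm0, hr0, hxr, hsize, hT, hkey⟩ :=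
    exists_word_dimensions hx32 hτ1 hℓ hx6
  have hxT : x ≤ (u : ℝ) / (2 * r ^ 2) := le_trans (le_mul_of_one_le_left hx0.le hτ1) hT
  have hτT : τ ≤ (u : ℝ) / (2 * r ^ 2) :=
    le_trans (le_mul_of_one_le_right (by linarith) (by linarith)) hT
  have hmr : m * r ≤ n := by
    refine le_trans ?_ hsize
    calc m * r = 1 * (m * r * 1) := by ring
      _ ≤ u * (m * r * (2 * l + 4)) := by gcongr <;> omega
  have hum : u * m ≤ n := by
    refine le_trans ?_ hsize
    calc u * m = u * (m * 1 * 1) := by ring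
      _ ≤ u * (m * r * (2 * l + 4)) := by gcongr <;> omega
  have hnl : 2 * (m * r) ≤ 2 ^ l := by
    have h1 : n < 2 ^ (Nat.log 2 n + 1) := Nat.lt_pow_succ_log_self (by norm_num) n
    rw [hl, pow_succ]
    omega
  have hcode : u * m < r ^ (K - 1) := by
    refine lt_of_le_of_lt hum ?_
    have h1 : (n : ℝ) < (r : ℝ) ^ (K - 1) := by
      calc (n : ℝ) = (n : ℝ) ^ (1 : ℝ) := (Real.rpow_one _).symm
        _ < (n : ℝ) ^ (((K - 1 : ℕ) : ℝ) * δ) := by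
          refine Real.rpow_lt_rpow_of_exponent_lt hn1 ?_
          rwa [← div_lt_iff₀ hδ]
        _ = x ^ (K - 1) := (hxpow _).symm
        _ ≤ (r : ℝ) ^ (K - 1) := by gcongr
    exact_mod_cast h1
  have hmain := hP.le_space hK hu0 hm0 hr0 hnl hsize hcode hc hC hτT (hlog.trans hxT)
    (hlarge.trans hxT) hDS
  rw [← hM] at hmain
  have hs0 : 0 ≤ s := nonneg_of_mul_nonneg_right (le_trans (by positivity) hmain) hMpos
  have hfinal : (n : ℝ) ^ 2 ≤ s * τ * x ^ 8 := by
    calc (n : ℝ) ^ 2 ≤ u * m ^ 2 * (256 * x ^ 7 * τ) := hkey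
      _ = u * m ^ 2 / 2 * (512 * x ^ 7 * τ) := by ring
      _ ≤ M * s * (512 * x ^ 7 * τ) := by gcongr
      _ = (512 * M) * (s * τ * x ^ 7) := by ring
      _ ≤ x * (s * τ * x ^ 7) := by gcongr
      _ = _ := by ring
  have h8 := hxpow 8
  rw [Nat.cast_ofNat] at h8
  rw [Real.rpow_sub hn0, div_le_iff₀ (by positivity), ← h8]
  exact_mod_cast hfinal

/-- A property that holds eventually for every fixed `δ > 0` holds eventually along some sequence
tending to `0`. -/
theorem exists_tendsto_zero_eventually {p : ℕ → ℝ → Prop}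
    (h : ∀ δ : ℝ, 0 < δ → ∀ᶠ n in atTop, p n δ) :
    ∃ ε : ℕ → ℝ, Tendsto ε atTop (𝓝 0) ∧ ∀ᶠ n in atTop, p n (ε n) := by
  classical
  have h' : ∀ k : ℕ, ∃ N, ∀ n ≥ N, p n (1 / ((k : ℝ) + 1)) := fun k =>
    eventually_atTop.1 (h _ (by positivity))
  choose N hN using h'
  -- Diagonalisation: use the smallest `1 / (k + 1)` with `k ≤ n` whose threshold `N k` has been
  -- passed.
  let κ : ℕ → ℕ := fun n => Nat.findGreatest (fun k => N k ≤ n) n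
  have hκ : Tendsto κ atTop atTop := by
    refine tendsto_atTop.2 fun k => ?_
    filter_upwards [eventually_ge_atTop (max k (N k))] with n hn
    exact Nat.le_findGreatest ((le_max_left _ _).trans hn) ((le_max_right _ _).trans hn)
  refine ⟨fun n => 1 / ((κ n : ℝ) + 1), tendsto_one_div_add_atTop_nhds_zero_nat.comp hκ, ?_⟩
  filter_upwards [eventually_ge_atTop (N 0)] with n hn
  exact hN (κ n) n (Nat.findGreatest_spec (P := fun k => N k ≤ n) (Nat.zero_le n) hn)

/-- The threshold is `τ = Q n`. When `Q n` is too large for the word construction, the nearly linear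
space bound `div_le_space` suffices. Quantifying over `S` and `Q` after `n` keeps the final error
term independent of them. -/
theorem ReportingProblem.HasWordInstances.eventually_space_mul_time {P : ReportingProblem}
    (hP : P.HasWordInstances) {c : ℝ} (hc : 0 < c) {δ : ℝ} (hδ : 0 < δ) :
    ∀ᶠ n : ℕ in atTop, ∀ S Q : ℕ → ℝ, (∀ n, 1 ≤ Q n) →
      P.HasDataStructure S (fun n m t => Q n + c * ((m : ℝ) + (t : ℝ))) →
      (n : ℝ) ^ (2 - δ) ≤ S n * Q n := by
  filter_upwards [hP.eventually_rpow_le (c := c + 1) (by positivity) (δ := δ / 8) (by positivity),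
    eventually_ge_atTop 12, eventually_const_le_rpow 12 (δ := δ / 4) (by positivity)]
    with n hn hn12 hx S Q hQ hDS
  have hn0 : (0 : ℝ) < n := by positivity
  rcases le_or_gt (Q n) ((n : ℝ) ^ (1 - 6 * (δ / 8))) with hle | hgt
  · have h1 := hn (S n) (Q n) (hQ n) hle fun I hI => ?_
    · rwa [show 2 - 8 * (δ / 8) = 2 - δ by ring] at h1
    · obtain ⟨G, hGs, hG⟩ := hDS I
      rw [hI] at hGs
      refine ⟨G, hGs, fun q hq => (hG q).mono ?_⟩
      rw [hI]
      have : (0 : ℝ) ≤ P.queryLength I q := by positivity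
      simp only
      linarith
  · have h1 : (n : ℝ) / 12 ≤ S n := hP.div_le_space hn12 fun I hI => by
      obtain ⟨G, hGs, hG⟩ := hDS I
      rw [hI] at hGs
      exact ⟨G, hGs, fun q => ⟨_, hG q⟩⟩
    have h2 : (n : ℝ) ^ (1 - δ / 4) ≤ n / 12 := by
      rw [Real.rpow_sub hn0, Real.rpow_one]
      gcongr
    calc (n : ℝ) ^ (2 - δ) = (n : ℝ) ^ (1 - δ / 4) * (n : ℝ) ^ (1 - 6 * (δ / 8)) := by
          rw [← Real.rpow_add hn0]; congr 1; ring
      _ ≤ S n * Q n := by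
          have h3 := h2.trans h1
          exact mul_le_mul h3 hgt.le (by positivity) (le_trans (by positivity) h3)

/-- The threshold is `τ = n ^ θ`, with `θ` chosen so that `(n * t) ^ (1 / 2 - α) ≤ t` for `t ≥ τ`;
the resulting exponent is `2 - θ` up to the error. -/
theorem ReportingProblem.HasWordInstances.eventually_space {P : ReportingProblem}
    (hP : P.HasWordInstances) {α : ℝ} (hα : 0 < α) (hα' : α < 1 / 2) {c : ℝ} (hc : 0 < c) {δ : ℝ}
    (hδ : 0 < δ) :
    ∀ᶠ n : ℕ in atTop, ∀ S : ℕ → ℝ,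
      P.HasDataStructure S
        (fun n m t => c * (((n : ℝ) * (t : ℝ)) ^ (1 / 2 - α) + (t : ℝ) + (m : ℝ) + 1)) →
      (n : ℝ) ^ ((1 + 6 * α) / (1 + 2 * α) - δ) ≤ S n := by
  have hα0 : 0 < 1 + 2 * α := by positivity
  set θ := (1 - 2 * α) / (1 + 2 * α) with hθ
  have hθ0 : 0 ≤ θ := div_nonneg (by linarith) hα0.le
  have hθ1 : 1 - θ = 4 * α / (1 + 2 * α) := by rw [hθ]; field_simp; ring
  have hθ2 : (1 + 6 * α) / (1 + 2 * α) = 2 - θ := by rw [hθ]; field_simp; ring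
  have hθpos : 0 < 1 - θ := by rw [hθ1]; positivity
  -- The second bound ensures `θ ≤ 1 - 6 * η`, so that `τ` is admissible; the first limits the loss
  -- `8 * η` to `δ`.
  set η := min (δ / 8) ((1 - θ) / 6) with hη
  have hη0 : 0 < η := lt_min (by positivity) (by positivity)
  have hη1 : η ≤ δ / 8 := min_le_left _ _
  have hη2 : η ≤ (1 - θ) / 6 := min_le_right _ _
  filter_upwards [hP.eventually_rpow_le (c := 3 * c) (by positivity) hη0, eventually_ge_atTop 1]
    with n hn hn1 S hDS
  have hn1' : (1 : ℝ) ≤ n := by exact_mod_cast hn1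
  have hn0 : (0 : ℝ) < n := by linarith
  have hτ1 : (1 : ℝ) ≤ (n : ℝ) ^ θ := Real.one_le_rpow hn1' hθ0
  have h1 := hn (S n) ((n : ℝ) ^ θ) hτ1
    (Real.rpow_le_rpow_of_exponent_le hn1' (by linarith)) fun I hI => ?_
  · have h2 : (n : ℝ) ^ (2 - 8 * η - θ) ≤ S n := by
      rw [Real.rpow_sub hn0, div_le_iff₀ (by positivity)]
      exact h1
    refine le_trans (Real.rpow_le_rpow_of_exponent_le hn1' ?_) h2
    rw [hθ2]
    linarith
  · obtain ⟨G, hGs, hG⟩ := hDS I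
    rw [hI] at hGs
    refine ⟨G, hGs, fun q hq => (hG q).mono ?_⟩
    rw [hI]
    set t : ℝ := ((P.answer I q).card : ℝ) with ht
    have ht1 : 1 ≤ t := hτ1.trans hq
    have ht0 : 0 < t := by linarith
    have h3 : ((n : ℝ) * t) ^ (1 / 2 - α) ≤ t := by
      calc ((n : ℝ) * t) ^ (1 / 2 - α) = (n : ℝ) ^ (1 / 2 - α) * t ^ (1 / 2 - α) :=
            Real.mul_rpow hn0.le ht0.le
        _ = ((n : ℝ) ^ θ) ^ (1 / 2 + α) * t ^ (1 / 2 - α) := by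
            rw [← Real.rpow_mul hn0.le]
            congr 2
            rw [hθ]
            field_simp
        _ ≤ t ^ (1 / 2 + α) * t ^ (1 / 2 - α) := by gcongr
        _ = t := by
            rw [← Real.rpow_add ht0]
            norm_num
    have h4 : (0 : ℝ) ≤ P.queryLength I q := by positivity
    calc c * (((n : ℝ) * t) ^ (1 / 2 - α) + t + P.queryLength I q + 1)
        ≤ c * (3 * (P.queryLength I q + t)) := by gcongr; linarith
      _ = _ := by ring

theorem mainTheorem1 (A : Type) [Nontrivial A] (P : ReportingProblem)
    (hP : P = twoPattern A ∨ P = forbiddenPattern A ∨ P = twoForbiddenPatterns A ∨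
      P = setIntersection) :
    (∀ c : ℝ, 0 < c → ∃ ε : ℕ → ℝ, Tendsto ε atTop (𝓝 0) ∧
      ∀ S Q : ℕ → ℝ, (∀ n, 1 ≤ Q n) →
        P.HasDataStructure S (fun n m t => Q n + c * ((m : ℝ) + (t : ℝ))) →
        ∃ C : ℝ, 0 < C ∧ ∀ᶠ n : ℕ in atTop, C * (n : ℝ) ^ (2 - ε n) ≤ S n * Q n) ∧
    (∀ α : ℝ, 0 < α → α < 1 / 2 → ∀ c : ℝ, 0 < c → ∃ ε : ℕ → ℝ, Tendsto ε atTop (𝓝 0) ∧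
      ∀ S : ℕ → ℝ,
        P.HasDataStructure S
          (fun n m t => c * (((n : ℝ) * (t : ℝ)) ^ (1 / 2 - α) + (t : ℝ) + (m : ℝ) + 1)) →
        ∃ C : ℝ, 0 < C ∧ ∀ᶠ n : ℕ in atTop,
          C * (n : ℝ) ^ ((1 + 6 * α) / (1 + 2 * α) - ε n) ≤ S n) := by
  have hW : P.HasWordInstances := by
    rcases hP with rfl | rfl | rfl | rfl
    · exact twoPattern_hasWordInstances A
    · exact forbiddenPattern_hasWordInstances A
    · exact twoForbiddenPatterns_hasWordInstances A
    · exact setIntersection_hasWordInstances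
  refine ⟨fun c hc => ?_, fun α hα hα' c hc => ?_⟩
  · obtain ⟨ε, hε, h⟩ := exists_tendsto_zero_eventually
      fun δ hδ => hW.eventually_space_mul_time hc hδ
    refine ⟨ε, hε, fun S Q hQ hDS => ⟨1, one_pos, ?_⟩⟩
    filter_upwards [h] with n hn
    rw [one_mul]
    exact hn S Q hQ hDS
  · obtain ⟨ε, hε, h⟩ := exists_tendsto_zero_eventually
      fun δ hδ => hW.eventually_space hα hα' hc hδ
    refine ⟨ε, hε, fun S hDS => ⟨1, one_pos, ?_⟩⟩
    filter_upwards [h] with n hn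
    rw [one_mul]
    exact hn S hDS
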